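/- Let $D([0,\infty),\mathbb{R})$ be the space of càdlàg paths $x:[0,\infty)\to\mathbb{R}$, with the Skorokhod topology given by $$d_\infty(x,y)=\sum_{T=1}^\infty 2^{-T}\bigl(1\wedge d_T(xg_T|_{[0,T]},\,yg_T|_{[0,T]})\bigr),\qquad g_T(t)=\max(0,\min(1,T-t)),$$ where, for $u,v:[0,T]\to\mathbb{R}$, $$d_T(u,v)=\inf_\lambda\Bigl\{\sup_{t\in[0,T]}|t-\lambda(t)|\vee\sup_{t\in[0,T]}|u(t)-v(\lambda(t))|\Bigr\},$$ the infimum being over all increasing bijections $\lambda$ of $[0,T]$. Let $(W(t))_{t\ge0}$ and $(\alpha(t))_{t\ge0}$ be real-valued stochastic processes on a common probability space, such that $W$ has sample paths in $D([0,\infty),\mathbb{R})$, $t+\alpha(t)\ge0$ for all $t\geq 0$, and the time-changed process $(W(t+\alpha(t)))_{t\ge0}$ has sample paths in $D([0,\infty),\mathbb{R})$. Let $B$ be a standard Brownian motion with continuous paths. Suppose that for every $T>0$ $$\sup_{0\le t\le T}\bigl|m^{-1}\alpha(mt)\bigr|\longrightarrow 0\quad\text{in probability as } m\to\infty .$$ If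 $(m^{-1/2}W(mt))_{t\ge0}$ converges in distribution as $m\to\infty$ to $(B(t))_{t\ge0}$ (resp. to $(|B(t)|)_{t\ge0}$) in $D([0,\infty),\mathbb{R})$, then $(m^{-1/2}W(mt+\alpha(mt)))_{t\ge0}$ converges in distribution as $m\to\infty$ to $(B(t))_{t\ge0}$ (resp. to $(|B(t)|)_{t\ge0}$) in $D([0,\infty),\mathbb{R})$. Here $m\to\infty$ through the positive reals. -/

import Mathlib

open MeasureTheory ProbabilityTheory Filter Topology
open scoped NNReal ENNReal

/-- A path `[0,∞) → ℝ` is càdlàg if it is right-continuous and has (finite) left limits. -/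
def IsCadlag (x : ℝ≥0 → ℝ) : Prop :=
  ∀ t : ℝ≥0, ContinuousWithinAt x (Set.Ici t) t ∧ ∃ l : ℝ, Tendsto x (𝓝[<] t) (𝓝 l)

theorem Continuous.isCadlag {x : ℝ≥0 → ℝ} (hx : Continuous x) : IsCadlag x := fun t =>
  ⟨hx.continuousWithinAt, x t, (hx.tendsto t).mono_left nhdsWithin_le_nhds⟩

theorem IsCadlag.scale {x : ℝ≥0 → ℝ} (hx : IsCadlag x) (c : ℝ) (m : ℝ≥0) :
    IsCadlag (fun t => c * x (m * t)) := by
  rcases eq_or_ne m 0 with rfl | hm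
  · simpa using (continuous_const (y := c * x 0)).isCadlag
  have hm' : 0 < m := pos_iff_ne_zero.2 hm
  have hc : Continuous fun t : ℝ≥0 => m * t := by fun_prop
  intro t
  refine ⟨?_, ?_⟩
  · have h := (hx (m * t)).1
    have h2 : ContinuousWithinAt (fun s : ℝ≥0 => x (m * s)) (Set.Ici t) t :=
      ContinuousWithinAt.comp (f := fun s : ℝ≥0 => m * s) (t := Set.Ici (m * t)) h
        hc.continuousWithinAt (fun s hs => mul_le_mul_right (show t ≤ s from hs) m)
    exact continuousWithinAt_const.mul h2
  · obtain ⟨l, hl⟩ := (hx (m * t)).2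
    refine ⟨c * l, Tendsto.const_mul c (hl.comp ?_)⟩
    refine tendsto_nhdsWithin_iff.2 ⟨(hc.tendsto t).mono_left nhdsWithin_le_nhds, ?_⟩
    filter_upwards [self_mem_nhdsWithin] with s hs
    exact mul_lt_mul_of_pos_left hs hm'

/-- The space `D([0,∞), ℝ)` of càdlàg paths. -/
@[ext]
structure SkorokhodSpace where
  path : ℝ≥0 → ℝ
  isCadlag : IsCadlag path

namespace SkorokhodSpace

/-- The cut-off function `g_T`: it equals `1` on `[0, T - 1]`, `T - t` on `[T - 1, T]`, and `0` on
`[T, ∞)`. -/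
noncomputable def cutoff (T t : ℝ≥0) : ℝ := max 0 (min 1 ((T : ℝ) - t))

/-- The truncated path `ψ_T(x)(t) = x(t) g_T(t)`, `0 ≤ t ≤ T`. -/
noncomputable def truncate (T : ℝ≥0) (x : ℝ≥0 → ℝ) (t : Set.Icc (0 : ℝ≥0) T) : ℝ :=
  x t * cutoff T t

/-- The Skorokhod distance `d_T` of two paths `[0,T] → ℝ`: the infimum over all increasing bijections
`e` of `[0,T]` (these are automatically continuous) of
`sup_t |t - e t| ∨ sup_t |x t - y (e t)|`. -/
noncomputable def distIcc (T : ℝ≥0) (x y : Set.Icc (0 : ℝ≥0) T → ℝ) : ℝ≥0∞ :=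
  ⨅ e : Set.Icc (0 : ℝ≥0) T ≃o Set.Icc (0 : ℝ≥0) T,
    max (⨆ t, edist t (e t)) (⨆ t, edist (x t) (y (e t)))

theorem distIcc_self (T : ℝ≥0) (x : Set.Icc (0 : ℝ≥0) T → ℝ) : distIcc T x x = 0 :=
  le_antisymm ((iInf_le _ (OrderIso.refl _)).trans (by simp)) bot_le

theorem distIcc_comm_le (T : ℝ≥0) (x y : Set.Icc (0 : ℝ≥0) T → ℝ) :
    distIcc T y x ≤ distIcc T x y := by
  refine le_iInf fun e => (iInf_le _ e.symm).trans ?_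
  refine max_le_max (iSup_le fun t => ?_) (iSup_le fun t => ?_)
  · refine le_trans ?_ (le_iSup _ (e.symm t))
    simp [edist_comm]
  · refine le_trans ?_ (le_iSup _ (e.symm t))
    simp [edist_comm]

theorem distIcc_comm (T : ℝ≥0) (x y : Set.Icc (0 : ℝ≥0) T → ℝ) :
    distIcc T x y = distIcc T y x :=
  le_antisymm (distIcc_comm_le T y x) (distIcc_comm_le T x y)

theorem distIcc_triangle (T : ℝ≥0) (x y z : Set.Icc (0 : ℝ≥0) T → ℝ) :
    distIcc T x z ≤ distIcc T x y + distIcc T y z := by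
  unfold distIcc
  rw [ENNReal.iInf_add]
  refine le_iInf fun e => ?_
  rw [ENNReal.add_iInf]
  refine le_iInf fun f => (iInf_le _ (e.trans f)).trans ?_
  refine max_le (iSup_le fun t => ?_) (iSup_le fun t => ?_)
  · refine (edist_triangle t (e t) (f (e t))).trans (add_le_add ?_ ?_)
    · exact (le_iSup (fun t => edist t (e t)) t).trans (le_max_left _ _)
    · exact (le_iSup (fun t => edist t (f t)) (e t)).trans (le_max_left _ _)
  · refine (edist_triangle (x t) (y (e t)) (z (f (e t)))).trans (add_le_add ?_ ?_)
    · exact (le_iSup (fun t => edist (x t) (y (e t))) t).trans (le_max_right _ _)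
    · exact (le_iSup (fun t => edist (y t) (z (f t))) (e t)).trans (le_max_right _ _)

/-- The Skorokhod distance on `D([0,∞), ℝ)`:
`d_∞(x,y) = ∑_{T = 1}^∞ 2^{-T} (1 ∧ d_T(ψ_T x, ψ_T y))` (the index `n` below is `T - 1`). -/
noncomputable instance : PseudoEMetricSpace SkorokhodSpace where
  edist x y := ∑' n : ℕ, (2 : ℝ≥0∞)⁻¹ ^ (n + 1) *
    min 1 (distIcc ((n : ℝ≥0) + 1) (truncate (n + 1) x.path) (truncate (n + 1) y.path))
  edist_self x := by simp [distIcc_self]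
  edist_comm x y := by simp only [distIcc_comm]
  edist_triangle x y z := by
    rw [← ENNReal.tsum_add]
    refine ENNReal.tsum_le_tsum fun n => ?_
    rw [← mul_add]
    refine mul_le_mul_right ?_ _
    refine (min_le_min_left 1 (distIcc_triangle _ _ (truncate (n + 1) y.path) _)).trans ?_
    rcases le_total 1 (distIcc ((n : ℝ≥0) + 1) (truncate (n + 1) x.path)
      (truncate (n + 1) y.path)) with h | h
    · rw [min_eq_left h]; exact (min_le_left _ _).trans le_self_add
    rcases le_total 1 (distIcc ((n : ℝ≥0) + 1) (truncate (n + 1) y.path)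
      (truncate (n + 1) z.path)) with h' | h'
    · rw [min_eq_left h']; exact (min_le_left _ _).trans le_add_self
    · rw [min_eq_right h, min_eq_right h']; exact min_le_right _ _

noncomputable instance : MeasurableSpace SkorokhodSpace := borel SkorokhodSpace

instance : BorelSpace SkorokhodSpace := ⟨rfl⟩

end SkorokhodSpace

/-!
The limit processes have continuous paths, and near a continuous path the Skorokhod topology is that
of locally uniform convergence (`SkorokhodSpace.tendsto_nhds_of_forall_abs_sub_le`,
`SkorokhodSpace.eventually_abs_sub_le_of_tendsto_nhds`). Hence, if `x` is close to a continuous path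
`y` and `τ` is close to the identity on a long interval, then `x ∘ τ` is close to `y` as well
(`SkorokhodSpace.exists_mem_nhds_of_timeChange`). The rescaled time-changed process is the
rescaled process composed with `τ t = t + m⁻¹ α (m t)`, and `τ` tends to the identity locally
uniformly in probability. For an open set `G`, the continuous paths in `G` are thus covered by an
increasing sequence of open sets `U k` such that, with probability tending to one, `X ∈ U k` forces
`X ∘ τ ∈ G`; the portmanteau theorem then transfers convergence in distribution from `X` to `X ∘ τ`
(`MeasureTheory.TendstoInDistribution.of_forall_isOpen`). Nothing about Brownian motion is needed
beyond the continuity of its paths.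

Convergence in distribution also requires the time-changed process to be measurable for the Borel
`σ`-algebra of the Skorokhod space, whereas only its values at fixed times are evidently measurable.
`SkorokhodSpace.measurable_of_eval` bridges the gap: a càdlàg path is the Skorokhod limit of the step
paths that sample it on the grids `{k / n}` (`SkorokhodSpace.tendsto_step`), and these depend
continuously on the sampled values.
-/

/-! ### Skorokhod convergence and locally uniform convergence -/

namespace SkorokhodSpace

theorem edist_def (x y : SkorokhodSpace) :
    edist x y = ∑' n : ℕ, (2 : ℝ≥0∞)⁻¹ ^ (n + 1) *
      min 1 (distIcc ((n : ℝ≥0) + 1) (truncate (n + 1) x.path) (truncate (n + 1) y.path)) := rfl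

theorem cutoff_nonneg (T t : ℝ≥0) : 0 ≤ cutoff T t := le_max_left _ _

theorem cutoff_le_one (T t : ℝ≥0) : cutoff T t ≤ 1 :=
  max_le zero_le_one (min_le_left _ _)

theorem cutoff_eq_one {T t : ℝ≥0} (h : t + 1 ≤ T) : cutoff T t = 1 := by
  have h' : (t : ℝ) + 1 ≤ T := by exact_mod_cast h
  rw [cutoff, min_eq_left (by linarith), max_eq_right zero_le_one]

theorem abs_cutoff_sub_cutoff_le (T s t : ℝ≥0) : |cutoff T s - cutoff T t| ≤ |(s : ℝ) - t| := by
  refine (abs_max_sub_max_le_max _ _ _ _).trans (max_le (by simp) ?_)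
  refine (abs_min_sub_min_le_max _ _ _ _).trans (max_le (by simp) ?_)
  rw [abs_sub_comm (s : ℝ)]
  exact le_of_eq (by ring_nf)

theorem continuous_cutoff (T : ℝ≥0) : Continuous (cutoff T) := by
  unfold cutoff; fun_prop

/-- Since the series defining `d_∞` is dominated by a geometric one, convergence for `d_∞` is
convergence of each of the truncated distances. -/
theorem tendsto_nhds_iff_distIcc {ι : Type*} {l : Filter ι} [l.IsCountablyGenerated]
    {x : ι → SkorokhodSpace} {y : SkorokhodSpace} :
    Tendsto x l (𝓝 y) ↔ ∀ n : ℕ, Tendsto (fun i => distIcc ((n : ℝ≥0) + 1)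
      (truncate (n + 1) (x i).path) (truncate (n + 1) y.path)) l (𝓝 0) := by
  rw [tendsto_iff_edist_tendsto_0]
  have hpos (n : ℕ) : (2 : ℝ≥0∞)⁻¹ ^ (n + 1) ≠ 0 := by simp
  have htop (n : ℕ) : (2 : ℝ≥0∞)⁻¹ ^ (n + 1) ≠ ∞ := by simp
  constructor
  · intro h n
    have h1 : Tendsto (fun i => min 1 (distIcc ((n : ℝ≥0) + 1)
        (truncate (n + 1) (x i).path) (truncate (n + 1) y.path))) l (𝓝 0) := by
      have h2 := ENNReal.Tendsto.const_mul (a := ((2 : ℝ≥0∞)⁻¹ ^ (n + 1))⁻¹) h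
        (Or.inr (ENNReal.inv_ne_top.2 (hpos n)))
      rw [mul_zero] at h2
      refine tendsto_of_tendsto_of_tendsto_of_le_of_le tendsto_const_nhds h2
        (fun _ => bot_le) fun i => ?_
      dsimp only
      rw [← ENNReal.mul_le_iff_le_inv (hpos n) (htop n), edist_def]
      exact ENNReal.le_tsum n
    rw [ENNReal.tendsto_nhds_zero] at h1 ⊢
    intro ε hε
    filter_upwards [h1 (min ε 2⁻¹) (lt_min hε (by simp))] with i hi
    rcases min_le_iff.1 hi with h' | h'
    · exact absurd (h'.trans (min_le_right _ _)) (by simp)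
    · exact h'.trans (min_le_left _ _)
  · intro h
    simp only [edist_def, ← lintegral_count]
    have h0 : ∫⁻ _ : ℕ, (0 : ℝ≥0∞) ∂Measure.count = 0 := by simp
    rw [← h0]
    refine tendsto_lintegral_filter_of_dominated_convergence
      (fun n : ℕ => (2 : ℝ≥0∞)⁻¹ ^ (n + 1)) (.of_forall fun i => measurable_from_top)
      (.of_forall fun i => .of_forall fun n => mul_le_of_le_one_right' (min_le_left _ _)) ?_ ?_
    · rw [lintegral_count, ENNReal.tsum_geometric_add_one]
      simp
    · refine .of_forall fun n => ?_
      have := ENNReal.Tendsto.const_mul (a := (2 : ℝ≥0∞)⁻¹ ^ (n + 1))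
        ((tendsto_const_nhds (x := (1 : ℝ≥0∞))).min (h n)) (Or.inr (htop n))
      simpa using this

/-- Locally uniform convergence implies convergence for the Skorokhod topology. -/
theorem tendsto_nhds_of_forall_abs_sub_le {ι : Type*} {l : Filter ι} [l.IsCountablyGenerated]
    {x : ι → SkorokhodSpace} {y : SkorokhodSpace}
    (h : ∀ (T : ℝ≥0) (ε : ℝ), 0 < ε → ∀ᶠ i in l, ∀ t ≤ T, |(x i).path t - y.path t| ≤ ε) :
    Tendsto x l (𝓝 y) := by
  refine tendsto_nhds_iff_distIcc.2 fun n => ENNReal.tendsto_nhds_zero.2 fun ε hε => ?_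
  obtain ⟨δ, hδ, hδε⟩ := ENNReal.lt_iff_exists_nnreal_btwn.1 hε
  filter_upwards [h (n + 1) δ (by exact_mod_cast hδ)] with i hi
  refine (iInf_le _ (OrderIso.refl _)).trans ((max_le (by simp) (iSup_le fun t => ?_)).trans hδε.le)
  rw [edist_dist, Real.dist_eq]
  refine ENNReal.ofReal_le_of_le_toReal ?_
  simp only [truncate, OrderIso.refl_apply, ENNReal.coe_toReal]
  rw [← sub_mul, abs_mul, abs_of_nonneg (cutoff_nonneg _ _)]
  exact (mul_le_of_le_one_right (abs_nonneg _) (cutoff_le_one _ _)).trans (hi t t.2.2)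

/-- Skorokhod convergence to a continuous path is locally uniform: the time changes tend to the
identity, and the limit is uniformly continuous on compact intervals. -/
theorem eventually_abs_sub_le_of_tendsto_nhds {ι : Type*} {l : Filter ι} [l.IsCountablyGenerated]
    {x : ι → SkorokhodSpace} {y : SkorokhodSpace} (hy : Continuous y.path)
    (h : Tendsto x l (𝓝 y)) (T : ℝ≥0) {ε : ℝ} (hε : 0 < ε) :
    ∀ᶠ i in l, ∀ t ≤ T, |(x i).path t - y.path t| ≤ ε := by
  obtain ⟨n, hn⟩ := exists_nat_ge T
  have hc : Continuous (truncate (n + 1) y.path) :=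
    (hy.comp continuous_subtype_val).mul ((continuous_cutoff _).comp continuous_subtype_val)
  have huc := CompactSpace.uniformContinuous_of_continuous hc
  obtain ⟨δ, hδ, hδε⟩ := Metric.uniformContinuous_iff.1 huc (ε / 2) (by positivity)
  have h0 : (0 : ℝ≥0∞) < min (ENNReal.ofReal δ) (ENNReal.ofReal (ε / 2)) := by
    simp [hδ, hε]
  filter_upwards [(tendsto_nhds_iff_distIcc.1 h n).eventually (gt_mem_nhds h0)] with i hi t ht
  obtain ⟨e, he⟩ := iInf_lt_iff.1 hi
  have htn : t + 1 ≤ (n : ℝ≥0) + 1 := by gcongr; exact ht.trans hn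
  let t' : Set.Icc (0 : ℝ≥0) (n + 1) := ⟨t, zero_le, le_self_add.trans htn⟩
  have h1 : dist t' (e t') < δ := by
    rw [← ENNReal.ofReal_lt_ofReal_iff hδ, ← edist_dist]
    exact ((le_iSup (fun t => edist t (e t)) t').trans (le_max_left _ _)).trans_lt
      (he.trans_le (min_le_left _ _))
  have h2 : dist (truncate (n + 1) (x i).path t') (truncate (n + 1) y.path (e t')) < ε / 2 := by
    rw [← ENNReal.ofReal_lt_ofReal_iff (by positivity), ← edist_dist]
    exact ((le_iSup (fun t => edist (truncate (n + 1) (x i).path t)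
      (truncate (n + 1) y.path (e t))) t').trans (le_max_right _ _)).trans_lt
      (he.trans_le (min_le_right _ _))
  have h3 := hδε h1
  have h4 := dist_triangle_right (truncate (n + 1) (x i).path t') (truncate (n + 1) y.path t')
    (truncate (n + 1) y.path (e t'))
  have h5 (z : ℝ≥0 → ℝ) : truncate (n + 1) z t' = z t := by
    simp [truncate, t', cutoff_eq_one htn]
  rw [h5, h5] at h4
  rw [h5] at h2 h3
  rw [← Real.dist_eq]
  linarith

/-- If `x` is near a continuous path `y` and `τ` is near the identity on a long interval, then any
path `z` that agrees with `x ∘ τ` on that interval is near `y`. This fails when `y` has jumps: `τ`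
need not be increasing, and may skip or repeat a jump. -/
theorem exists_mem_nhds_of_timeChange {y : SkorokhodSpace} (hy : Continuous y.path)
    {G : Set SkorokhodSpace} (hG : G ∈ 𝓝 y) :
    ∃ k : ℕ, {x : SkorokhodSpace | ∀ (τ : ℝ≥0 → ℝ≥0) (z : SkorokhodSpace),
      (∀ t ≤ (k : ℝ≥0) + 1, dist (τ t) t ≤ 1 / ((k : ℝ) + 1) ∧ z.path t = x.path (τ t)) → z ∈ G} ∈
        𝓝 y := by
  by_contra! hcon
  have hex (k : ℕ) : ∃ x : SkorokhodSpace, edist x y < (k : ℝ≥0∞)⁻¹ ∧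
      ∃ (τ : ℝ≥0 → ℝ≥0) (z : SkorokhodSpace), (∀ t ≤ (k : ℝ≥0) + 1,
        dist (τ t) t ≤ 1 / ((k : ℝ) + 1) ∧ z.path t = x.path (τ t)) ∧ z ∉ G := by
    by_contra! h
    refine hcon k (mem_of_superset (Metric.eball_mem_nhds y (ε := (k : ℝ≥0∞)⁻¹) (by simp)) ?_)
    exact fun x hx τ z hz => h x hx τ z hz
  choose x hx τ z hz hzG using hex
  have hxy : Tendsto x atTop (𝓝 y) := by
    rw [tendsto_iff_edist_tendsto_0]
    exact tendsto_of_tendsto_of_tendsto_of_le_of_le tendsto_const_nhds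
      ENNReal.tendsto_inv_nat_nhds_zero (fun _ => bot_le) fun k => (hx k).le
  refine absurd (?_ : Tendsto z atTop (𝓝 y)) fun h => ?_
  · refine tendsto_nhds_of_forall_abs_sub_le fun T ε hε => ?_
    have huc := isCompact_Icc.uniformContinuousOn_of_continuous
      (hy.continuousOn (s := Set.Icc 0 (T + 1)))
    obtain ⟨δ, hδ, hδε⟩ := Metric.uniformContinuousOn_iff.1 huc (ε / 2) (by positivity)
    filter_upwards [eventually_abs_sub_le_of_tendsto_nhds hy hxy (T + 1) (half_pos hε),
      tendsto_natCast_atTop_atTop.eventually (eventually_ge_atTop T),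
      tendsto_one_div_add_atTop_nhds_zero_nat.eventually (gt_mem_nhds hδ)] with k h1 h2 h3 t ht
    obtain ⟨h4, h5⟩ := hz k t ((ht.trans h2).trans le_self_add)
    have h6 : τ k t ≤ T + 1 := by
      rw [NNReal.dist_eq] at h4
      have h7 : (1 : ℝ) / (k + 1) ≤ 1 := by
        rw [div_le_one (by positivity)]; simp
      have h8 := (abs_le.1 h4).2
      rw [← NNReal.coe_le_coe] at ht ⊢
      push_cast
      linarith
    have h9 := h1 _ h6
    have h10 := hδε (τ k t) ⟨zero_le, h6⟩ t ⟨zero_le, ht.trans le_self_add⟩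
      (h4.trans_lt h3)
    rw [h5]
    rw [Real.dist_eq] at h10
    exact (abs_sub_le _ _ _).trans (by linarith)
  · obtain ⟨k, hk⟩ := (h.eventually hG).exists
    exact hzG k hk

end SkorokhodSpace

/-! ### Oscillation of càdlàg paths -/

/-- A càdlàg path has oscillation at most `ε` on each of the finitely many half-open intervals that
a suitable finite set `S` cuts out of `[0, T]`: the path varies by at most `ε` between two times that
are not separated by `S`. -/
theorem IsCadlag.exists_finset_abs_sub_le {x : ℝ≥0 → ℝ} (hx : IsCadlag x) (T : ℝ≥0) {ε : ℝ}
    (hε : 0 < ε) :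
    ∃ S : Finset ℝ≥0, ∀ s t, s ≤ t → t ≤ T → (∀ p ∈ S, p ≤ t → p ≤ s) → |x s - x t| ≤ ε := by
  let good (b : ℝ≥0) : Prop :=
    ∃ S : Finset ℝ≥0, ∀ s t, s ≤ t → t ≤ b → (∀ p ∈ S, p ≤ t → p ≤ s) → |x s - x t| ≤ ε
  have close {u v l : ℝ} (hu : |u - l| < ε / 2) (hv : |v - l| < ε / 2) : |u - v| ≤ ε := by
    have := abs_sub_le u l v
    rw [abs_sub_comm l] at this
    linarith
  have mono {a b : ℝ≥0} (hab : a ≤ b) : good b → good a := fun ⟨S, hS⟩ =>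
    ⟨S, fun s t hst ht => hS s t hst (ht.trans hab)⟩
  by_contra hT
  have hne : {b | ¬ good b}.Nonempty := ⟨T, hT⟩
  set c := sInf {b | ¬ good b} with hc
  have hlt {b : ℝ≥0} (hb : b < c) : good b := by
    by_contra h
    exact (csInf_le (OrderBot.bddBelow _) h).not_gt hb
  -- the existence of a left limit at `c` carries the property up to `c`
  have hgc : good c := by
    rcases eq_zero_or_pos c with h0 | h0
    · refine ⟨∅, fun s t hst ht _ => ?_⟩
      have ht0 : t = 0 := by rw [h0] at ht; exact le_antisymm ht zero_le
      have hs0 : s = 0 := le_antisymm (hst.trans ht0.le) zero_le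
      simp [ht0, hs0, hε.le]
    obtain ⟨l, hl⟩ := (hx c).2
    have hev := hl.eventually (Metric.ball_mem_nhds l (half_pos hε))
    obtain ⟨a, ha, hac⟩ := (mem_nhdsLT_iff_exists_Ioo_subset' h0).1 hev
    obtain ⟨b, hab, hbc⟩ := exists_between (show a < c from ha)
    obtain ⟨S, hS⟩ := hlt hbc
    refine ⟨insert b (insert c S), fun s t hst ht hp => ?_⟩
    simp only [Finset.mem_insert, forall_eq_or_imp] at hp
    rcases ht.eq_or_lt with rfl | htc
    · rw [le_antisymm hst (hp.2.1 le_rfl)]; simp [hε.le]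
    rcases le_total t b with htb | htb
    · exact hS s t hst htb hp.2.2
    have hsb := hp.1 htb
    exact close (hac ⟨hab.trans_le hsb, hst.trans_lt htc⟩) (hac ⟨hab.trans_le htb, htc⟩)
  -- right continuity carries it beyond `c`
  obtain ⟨S, hS⟩ := hgc
  have hev := (hx c).1.eventually (Metric.ball_mem_nhds (x c) (half_pos hε))
  obtain ⟨d, hd, hcd⟩ := (mem_nhdsGE_iff_exists_Ico_subset' (show c < c + 1 by simp)).1 hev
  obtain ⟨b, hcb, hbd⟩ := exists_between (show c < d from hd)
  have hgb : good b := by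
    refine ⟨insert c S, fun s t hst ht hp => ?_⟩
    simp only [Finset.mem_insert, forall_eq_or_imp] at hp
    rcases le_total t c with htc | htc
    · exact hS s t hst htc hp.2
    exact close (hcd ⟨hp.1 htc, (hst.trans ht).trans_lt hbd⟩) (hcd ⟨htc, ht.trans_lt hbd⟩)
  refine hcb.not_ge ?_
  rw [hc]
  refine le_csInf hne fun b' hb' => ?_
  by_contra! h
  exact hb' (mono h.le hgb)

/-- A càdlàg path is bounded on compact intervals. -/
theorem IsCadlag.exists_abs_le {x : ℝ≥0 → ℝ} (hx : IsCadlag x) (T : ℝ≥0) :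
    ∃ M : ℝ, 0 ≤ M ∧ ∀ t ≤ T, |x t| ≤ M := by
  obtain ⟨S, hS⟩ := hx.exists_finset_abs_sub_le T one_pos
  refine ⟨1 + ∑ p ∈ insert 0 S, |x p|, by positivity, fun t ht => ?_⟩
  -- compare `x t` with the value at the last point of `S` before `t`
  obtain ⟨p, hp, hmax⟩ := ((insert 0 S).filter (· ≤ t)).exists_max_image id
    ⟨0, by simp⟩
  rw [Finset.mem_filter] at hp
  have h1 := hS p t hp.2 ht fun q hq hqt => hmax q (by simp [hq, hqt])
  have h2 : |x p| ≤ ∑ p ∈ insert 0 S, |x p| :=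
    Finset.single_le_sum (f := fun p => |x p|) (fun _ _ => abs_nonneg _) hp.1
  have h3 := abs_sub_abs_le_abs_sub (x t) (x p)
  rw [abs_sub_comm] at h3
  linarith

/-! ### Time changes that move finitely many points to a grid -/

/-- A perturbation of the identity of `[0, T]` by a function with Lipschitz constant less than `1`
that vanishes at both ends is an increasing bijection. -/
theorem exists_orderIso_Icc_eq_add {T : ℝ≥0} {h : ℝ → ℝ} {K : ℝ} (hK : K < 1)
    (hL : ∀ s t, |h s - h t| ≤ K * |s - t|) (h0 : h 0 = 0) (hT : h T = 0) :
    ∃ e : Set.Icc (0 : ℝ≥0) T ≃o Set.Icc (0 : ℝ≥0) T,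
      ∀ t, ((e t : ℝ≥0) : ℝ) = (t : ℝ≥0) + h (t : ℝ≥0) := by
  have hmono : StrictMono fun t => t + h t := fun s t hst => by
    have h1 := hL s t
    rw [abs_of_neg (sub_neg.2 hst)] at h1
    have h2 := (abs_le.1 h1).2
    dsimp only
    nlinarith
  have hcont : Continuous h := by
    refine (LipschitzWith.of_dist_le_mul (K := K.toNNReal) fun s t => ?_).continuous
    rw [Real.dist_eq, Real.dist_eq]
    exact (hL s t).trans (mul_le_mul_of_nonneg_right (Real.le_coe_toNNReal K) (abs_nonneg _))
  have hnn (t : ℝ≥0) : 0 ≤ (t : ℝ) + h t := by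
    have := hmono.monotone t.2
    simpa [h0] using this
  have hle (t : Set.Icc (0 : ℝ≥0) T) : ((t : ℝ≥0) : ℝ) + h (t : ℝ≥0) ≤ T := by
    have := hmono.monotone (NNReal.coe_le_coe.2 t.2.2)
    simpa [hT] using this
  let f (t : Set.Icc (0 : ℝ≥0) T) : Set.Icc (0 : ℝ≥0) T :=
    ⟨⟨(t : ℝ≥0) + h (t : ℝ≥0), hnn t⟩, zero_le, hle t⟩
  have hf : StrictMono f := fun s t hst => hmono (NNReal.coe_lt_coe.2 hst)
  suffices hsurj : Function.Surjective f from
    ⟨hf.orderIsoOfSurjective f hsurj, fun t => rfl⟩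
  intro u
  obtain ⟨t, ht, htu⟩ := intermediate_value_Icc T.2
    (f := fun t => t + h t) (continuous_id.add hcont).continuousOn
    (show ((u : ℝ≥0) : ℝ) ∈ _ from ⟨by simp [h0], by
      simp only [NNReal.val_eq_coe, hT, add_zero]; exact u.2.2⟩)
  exact ⟨⟨⟨t, ht.1⟩, zero_le, ht.2⟩, Subtype.ext (NNReal.eq htu)⟩

/-- On an interval of integer length, finitely many given points can be moved up to the grid
`{k / n}` by an increasing bijection that is uniformly close to the identity. -/
theorem eventually_exists_orderIso_eq_ceil {T : ℝ≥0} (hT : ∃ N : ℕ, T = N) (S : Finset ℝ≥0) :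
    ∀ᶠ n : ℕ in atTop, ∃ e : Set.Icc (0 : ℝ≥0) T ≃o Set.Icc (0 : ℝ≥0) T,
      (∀ t : Set.Icc (0 : ℝ≥0) T, |((t : ℝ≥0) : ℝ) - (e t : ℝ≥0)| ≤ S.card * (n : ℝ)⁻¹) ∧
      ∀ t : Set.Icc (0 : ℝ≥0) T, (t : ℝ≥0) ∈ S → n * (e t : ℝ≥0) = ⌈n * (t : ℝ≥0)⌉₊ := by
  obtain ⟨η, hsep, hη : 0 < η⟩ : ∃ η : ℝ, (∀ p ∈ insert 0 (insert T S), ∀ q ∈ insert 0 (insert T S),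
      p ≠ q → η ≤ |(p : ℝ) - q|) ∧ 0 < η := by
    refine Eventually.exists (f := 𝓝[>] (0 : ℝ)) (.and ?_ self_mem_nhdsWithin)
    refine (Finset.eventually_all _).2 fun p _ => (Finset.eventually_all _).2 fun q _ => ?_
    refine eventually_imp_distrib_left.2 fun hpq => ?_
    have : 0 < |(p : ℝ) - q| := abs_pos.2 (sub_ne_zero.2 (NNReal.coe_injective.ne hpq))
    exact eventually_nhdsWithin_of_eventually_nhds (tendsto_id.eventually_le_const this)
  -- each displacement is at most `1 / n`, so this bounds the Lipschitz constant of their sum below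
  have hsmall : ∀ᶠ n : ℕ in atTop, S.card * (n : ℝ)⁻¹ * η⁻¹ < 1 := by
    have : Tendsto (fun n : ℕ => S.card * (n : ℝ)⁻¹ * η⁻¹) atTop (𝓝 (S.card * 0 * η⁻¹)) :=
      (tendsto_inv_atTop_nhds_zero_nat.const_mul _).mul_const _
    rw [mul_zero, zero_mul] at this
    exact this.eventually (gt_mem_nhds one_pos)
  filter_upwards [hsmall, eventually_gt_atTop 0] with n hn hn0
  have hn0' : (0 : ℝ) < n := by exact_mod_cast hn0
  -- the displacement of `p ∈ S`, interpolated by tents of radius `η` around the points of `S`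
  let c (p : ℝ≥0) : ℝ := ⌈n * p⌉₊ * (n : ℝ)⁻¹ - p
  let φ (p : ℝ≥0) (t : ℝ) : ℝ := max 0 (1 - |t - p| * η⁻¹)
  let h (t : ℝ) : ℝ := ∑ p ∈ S, c p * φ p t
  have hc (p : ℝ≥0) : |c p| ≤ (n : ℝ)⁻¹ := by
    have h1 : ((n * p : ℝ≥0) : ℝ) ≤ ⌈n * p⌉₊ := by exact_mod_cast Nat.le_ceil (n * p)
    have h2 : (⌈n * p⌉₊ : ℝ) ≤ ((n * p : ℝ≥0) : ℝ) + 1 := by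
      exact_mod_cast (Nat.ceil_lt_add_one (zero_le : 0 ≤ n * p)).le
    push_cast at h1 h2
    have h3 : c p = (⌈n * p⌉₊ - n * (p : ℝ)) * (n : ℝ)⁻¹ := by
      simp only [c]; field_simp
    rw [h3, abs_mul, abs_of_nonneg (by linarith), abs_of_nonneg (by positivity)]
    exact mul_le_of_le_one_left (by positivity) (by linarith)
  have hφ (p : ℝ≥0) (t : ℝ) : |φ p t| ≤ 1 := by
    rw [abs_of_nonneg (le_max_left _ _)]
    exact max_le zero_le_one (sub_le_self _ (by positivity))
  have hφL (p : ℝ≥0) (s t : ℝ) : |φ p s - φ p t| ≤ η⁻¹ * |s - t| := by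
    refine (abs_max_sub_max_le_max _ _ _ _).trans (max_le (by simp; positivity) ?_)
    rw [sub_sub_sub_cancel_left, ← sub_mul, abs_mul, abs_of_pos (inv_pos.2 hη), mul_comm]
    refine mul_le_mul_of_nonneg_left ((abs_abs_sub_abs_le _ _).trans ?_) (by positivity)
    rw [sub_sub_sub_cancel_right, abs_sub_comm]
  have hφ0 {p q : ℝ≥0} (hp : p ∈ S) (hq : q ∈ insert 0 (insert T S)) (hpq : p ≠ q) :
      φ p q = 0 := by
    refine max_eq_left (sub_nonpos.2 ?_)
    rw [← div_eq_mul_inv, le_div_iff₀ hη, one_mul]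
    exact hsep q hq p (by simp [hp]) hpq.symm
  have hhS {q : ℝ≥0} (hq : q ∈ S) : h q = c q := by
    simp only [h]
    rw [Finset.sum_eq_single_of_mem q hq fun p hp hpq => by rw [hφ0 hp (by simp [hq]) hpq, mul_zero]]
    simp [φ]
  -- the grid contains both ends, which therefore do not move
  have hend {q : ℝ≥0} (hq : q ∈ insert 0 (insert T S)) (hcq : c q = 0) : h q = 0 := by
    refine Finset.sum_eq_zero fun p hp => ?_
    rcases eq_or_ne p q with rfl | hpq
    · rw [hcq, zero_mul]
    · rw [hφ0 hp hq hpq, mul_zero]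
  have hc0 : c 0 = 0 := by simp [c]
  have hcT : c T = 0 := by
    obtain ⟨N, rfl⟩ := hT
    simp only [c]
    rw [← Nat.cast_mul, Nat.ceil_natCast]
    push_cast
    field_simp
    simp
  obtain ⟨e, he⟩ := exists_orderIso_Icc_eq_add (T := T) (h := h) hn (fun s t => by
    simp only [h]
    rw [← Finset.sum_sub_distrib]
    refine (Finset.abs_sum_le_sum_abs _ _).trans ((Finset.sum_le_card_nsmul _ _
      ((n : ℝ)⁻¹ * (η⁻¹ * |s - t|)) fun p _ => ?_).trans_eq ?_)
    · rw [← mul_sub, abs_mul]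
      exact mul_le_mul (hc p) (hφL p s t) (abs_nonneg _) (by positivity)
    · rw [nsmul_eq_mul]; ring) (by simpa using hend (q := 0) (by simp) hc0)
    (hend (by simp) hcT)
  refine ⟨e, fun t => ?_, fun t ht => ?_⟩
  · rw [he, sub_add_cancel_left, abs_neg]
    refine (Finset.abs_sum_le_sum_abs _ _).trans ((Finset.sum_le_card_nsmul _ _
      (n : ℝ)⁻¹ fun p _ => ?_).trans_eq (nsmul_eq_mul _ _))
    rw [abs_mul]
    exact (mul_le_of_le_one_right (abs_nonneg _) (hφ p _)).trans (hc p)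
  · rw [← NNReal.coe_inj]
    push_cast
    rw [he, hhS ht]
    simp only [c]
    field_simp
    ring

/-! ### Measurability of càdlàg processes -/

namespace SkorokhodSpace

/-- The step path with value `a k` on `[k / n, (k + 1) / n)` (for `n = 0`, the constant `a 0`). -/
noncomputable def step (n : ℕ) (a : ℕ → ℝ) : SkorokhodSpace where
  path t := a ⌊(n : ℝ≥0) * t⌋₊
  isCadlag := by
    have h : IsCadlag fun t : ℝ≥0 => a ⌊t⌋₊ := fun t => by
      refine ⟨?_, ?_⟩
      · refine tendsto_const_nhds.congr' ?_
        have h1 : ∀ᶠ s in 𝓝[≥] t, s < (⌊t⌋₊ : ℝ≥0) + 1 :=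
          eventually_nhdsWithin_of_eventually_nhds (gt_mem_nhds (Nat.lt_floor_add_one t))
        filter_upwards [h1, self_mem_nhdsWithin] with s hs hts
        congr 1
        exact (((Nat.floor_eq_iff zero_le).2
          ⟨(Nat.floor_le zero_le).trans hts, hs⟩)).symm
      · refine ⟨a (⌈t⌉₊ - 1), tendsto_const_nhds.congr' ?_⟩
        rcases eq_zero_or_pos t with rfl | ht
        · rw [← bot_eq_zero, Set.Iio_bot, nhdsWithin_empty]
          exact eventually_bot
        have hc : 0 < ⌈t⌉₊ := Nat.ceil_pos.2 ht
        have hcast : ((⌈t⌉₊ - 1 : ℕ) : ℝ≥0) + 1 = ⌈t⌉₊ := by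
          exact_mod_cast congrArg (Nat.cast (R := ℝ≥0)) (Nat.sub_add_cancel hc)
        have h1 : ((⌈t⌉₊ - 1 : ℕ) : ℝ≥0) < t := Nat.lt_ceil.1 (by omega)
        filter_upwards [eventually_nhdsWithin_of_eventually_nhds (lt_mem_nhds h1),
          self_mem_nhdsWithin] with s hs hts
        congr 1
        refine ((Nat.floor_eq_iff zero_le).2 ⟨hs.le, ?_⟩).symm
        rw [hcast]
        exact (show s < t from hts).trans_le (Nat.le_ceil t)
    simpa using h.scale 1 n

/-- A step path depends continuously on its values. -/
theorem continuous_step (n : ℕ) : Continuous (step n) := by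
  refine continuous_iff_continuousAt.2 fun a => tendsto_nhds_of_forall_abs_sub_le fun T ε hε => ?_
  have h : ∀ᶠ b : ℕ → ℝ in 𝓝 a, ∀ k ∈ Finset.range (⌊n * T⌋₊ + 1), |b k - a k| ≤ ε := by
    refine (Finset.eventually_all _).2 fun k _ => ?_
    filter_upwards [(continuous_apply k).continuousAt.eventually
      (Metric.closedBall_mem_nhds (a k) hε)] with b hb
    exact hb
  filter_upwards [h] with b hb t ht
  exact hb _ (Finset.mem_range_succ_iff.2 (Nat.floor_mono (by gcongr)))

/-- The step paths that sample a càdlàg path on the grids `{k / n}` converge to it: the times that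
cut it into pieces of small oscillation can be moved to the grid by a small time change, which makes
the steps fit the pieces. -/
theorem tendsto_step (x : SkorokhodSpace) :
    Tendsto (fun n : ℕ => step n fun k => x.path (k / n)) atTop (𝓝 x) := by
  refine tendsto_nhds_iff_distIcc.2 fun N => ENNReal.tendsto_nhds_zero.2 fun ε' hε' => ?_
  obtain ⟨ε, hε, hεε'⟩ := ENNReal.lt_iff_exists_nnreal_btwn.1 hε'
  replace hε : (0 : ℝ) < ε := by exact_mod_cast hε
  set T : ℝ≥0 := (N : ℝ≥0) + 1 with hTdef
  have hT : ∃ N : ℕ, T = N := ⟨N + 1, by simp [hTdef]⟩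
  obtain ⟨S, hS⟩ := x.isCadlag.exists_finset_abs_sub_le T (half_pos hε)
  obtain ⟨M, hM0, hM⟩ := x.isCadlag.exists_abs_le T
  have hsmall (C δ : ℝ) (hδ : 0 < δ) : ∀ᶠ n : ℕ in atTop, C * (S.card * (n : ℝ)⁻¹) ≤ δ := by
    have : Tendsto (fun n : ℕ => C * (S.card * (n : ℝ)⁻¹)) atTop (𝓝 (C * (S.card * 0))) :=
      (tendsto_inv_atTop_nhds_zero_nat.const_mul _).const_mul _
    rw [mul_zero, mul_zero] at this
    exact this.eventually_le_const hδ
  filter_upwards [eventually_exists_orderIso_eq_ceil hT S, hsmall 1 ε hε,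
    hsmall M (ε / 2) (half_pos hε), eventually_gt_atTop 0] with n ⟨e, he, heS⟩ h1 h2 hn
  have hn' : (0 : ℝ≥0) < n := by exact_mod_cast hn
  rw [distIcc_comm]
  have key {r s : ℝ} (h : |r - s| ≤ ε) : edist r s ≤ ε' := by
    rw [edist_dist, Real.dist_eq]
    exact (ENNReal.ofReal_le_of_le_toReal (by simpa using h)).trans hεε'.le
  refine (iInf_le _ e).trans (max_le (iSup_le fun t => key ?_) (iSup_le fun t => key ?_))
  · rw [one_mul] at h1
    exact (he t).trans h1
  -- `u` is the last grid point before `e t`; no point of `S` separates it from `t`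
  set u : ℝ≥0 := ⌊(n : ℝ≥0) * (e t : ℝ≥0)⌋₊ / n with hu
  have huT : u ≤ T := by
    refine le_trans ?_ (e t).2.2
    rw [hu, div_le_iff₀ hn', mul_comm]
    exact Nat.floor_le zero_le
  have hiff (p : ℝ≥0) (hp : p ∈ S) (hpT : p ≤ T) : p ≤ (t : ℝ≥0) ↔ p ≤ u := by
    have h3 := heS ⟨p, zero_le, hpT⟩ hp
    have h4 : p ≤ (t : ℝ≥0) ↔ (e ⟨p, zero_le, hpT⟩ : ℝ≥0) ≤ e t :=
      (e.le_iff_le (x := ⟨p, zero_le, hpT⟩) (y := t)).symm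
    rw [h4, ← mul_le_mul_iff_right₀ hn', h3, ← Nat.le_floor_iff zero_le, Nat.ceil_le, hu,
      le_div_iff₀ hn', mul_comm p]
  have hxu : |x.path t - x.path u| ≤ ε / 2 := by
    rcases le_total (t : ℝ≥0) u with htu | htu
    · exact hS _ _ htu huT fun p hp hpu => (hiff p hp (hpu.trans huT)).2 hpu
    · rw [abs_sub_comm]
      exact hS _ _ htu t.2.2 fun p hp hpt => (hiff p hp (hpt.trans t.2.2)).1 hpt
  change |x.path t * cutoff T t - x.path u * cutoff T (e t)| ≤ ε
  have h4 : x.path t * cutoff T t - x.path u * cutoff T (e t) =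
      (x.path t - x.path u) * cutoff T t + x.path u * (cutoff T t - cutoff T (e t)) := by ring
  rw [h4]
  refine (abs_add_le _ _).trans ?_
  rw [abs_mul, abs_mul, abs_of_nonneg (cutoff_nonneg _ _)]
  have h5 := mul_le_of_le_one_right (abs_nonneg (x.path t - x.path u)) (cutoff_le_one T t)
  have h6 := mul_le_mul (hM u huT) ((abs_cutoff_sub_cutoff_le T t (e t)).trans (he t))
    (abs_nonneg _) hM0
  linarith

/-- A process with càdlàg paths is a random element of the Skorokhod space: its Borel `σ`-algebra is
generated by the evaluations, as every path is a limit of step paths through its values. -/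
theorem measurable_of_eval {Ω : Type*} [MeasurableSpace Ω] {X : Ω → SkorokhodSpace}
    (hX : ∀ t, Measurable fun ω => (X ω).path t) : Measurable X := by
  refine measurable_of_tendsto_metrizable (f := fun (n : ℕ) ω => step n fun k => (X ω).path (k / n))
    (fun n => (continuous_step n).measurable.comp (measurable_pi_lambda _ fun k => hX _)) ?_
  exact tendsto_pi_nhds.2 fun ω => tendsto_step (X ω)

end SkorokhodSpace

/-- A right-continuous measurable process evaluated at a measurable random time is measurable. -/
theorem measurable_process_comp {Ω : Type*} [MeasurableSpace Ω] {X : ℝ≥0 → Ω → ℝ}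
    (hX : ∀ t, Measurable (X t)) (hpath : ∀ ω, IsCadlag fun t => X t ω) {τ : Ω → ℝ≥0}
    (hτ : Measurable τ) : Measurable fun ω => X (τ ω) ω := by
  -- approximate `τ` from above by grid times, which take countably many values
  refine measurable_of_tendsto_metrizable
    (f := fun (n : ℕ) ω => X ((⌊(n + 1) * τ ω⌋₊ + 1) / (n + 1)) ω) (fun n => ?_) ?_
  · have h {Y : ℕ → Ω → ℝ} (hY : ∀ k, Measurable (Y k)) {κ : Ω → ℕ} (hκ : Measurable κ) :
        Measurable fun ω => Y (κ ω) ω :=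
      (measurable_from_prod_countable_left (f := fun q : Ω × ℕ => Y q.2 q.1) hY).comp
        (measurable_id.prodMk hκ)
    exact h (Y := fun k => X ((k + 1) / (n + 1))) (fun k => hX _)
      (Nat.measurable_floor.comp (hτ.const_mul _))
  · refine tendsto_pi_nhds.2 fun ω => ((hpath ω (τ ω)).1).tendsto.comp ?_
    have hpos (n : ℕ) : (0 : ℝ≥0) < n + 1 := by positivity
    have hlow (n : ℕ) : τ ω ≤ (⌊(n + 1) * τ ω⌋₊ + 1) / (n + 1) := by
      rw [le_div_iff₀ (hpos n), mul_comm]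
      exact (Nat.lt_floor_add_one _).le
    refine tendsto_nhdsWithin_iff.2 ⟨?_, .of_forall hlow⟩
    have hlim : Tendsto (fun n : ℕ => τ ω + 1 / ((n : ℝ≥0) + 1)) atTop (𝓝 (τ ω + 0)) :=
      tendsto_const_nhds.add tendsto_one_div_add_atTop_nhds_zero_nat
    rw [add_zero] at hlim
    refine tendsto_of_tendsto_of_tendsto_of_le_of_le tendsto_const_nhds hlim hlow fun n => ?_
    dsimp only
    have hfl : (⌊(n + 1) * τ ω⌋₊ : ℝ≥0) ≤ (n + 1) * τ ω := Nat.floor_le zero_le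
    rw [div_le_iff₀ (hpos n), add_mul (τ ω), one_div, inv_mul_cancel₀ (hpos n).ne', mul_comm (τ ω)]
    gcongr

/-! ### Convergence in distribution under small time changes -/

/-- A converging-together criterion: convergence in distribution passes from `X` to `Y` if every
open set `G` is, up to a null event for the limit, exhausted by open sets `U k` such that
`X i ∈ U k` forces `Y i ∈ G` with probability tending to one. -/
theorem MeasureTheory.TendstoInDistribution.of_forall_isOpen {ι Ω Ω' E : Type*} [MeasurableSpace Ω]
    [MeasurableSpace Ω'] {P : Measure Ω} [IsProbabilityMeasure P] {P' : Measure Ω'}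
    [IsProbabilityMeasure P'] [TopologicalSpace E] [MeasurableSpace E] [BorelSpace E]
    [HasOuterApproxClosed E] {l : Filter ι} [l.IsCountablyGenerated] {X Y : ι → Ω → E}
    {Z : Ω' → E} (hX : TendstoInDistribution X l Z (fun _ => P) P')
    (hY : ∀ i, AEMeasurable (Y i) P)
    (h : ∀ G, IsOpen G → ∃ U : ℕ → Set E, Monotone U ∧ (∀ k, IsOpen (U k)) ∧
      (∀ᵐ ω ∂P', Z ω ∈ G → ∃ k, Z ω ∈ U k) ∧
      ∀ k, Tendsto (fun i => P {ω | X i ω ∈ U k ∧ Y i ω ∉ G}) l (𝓝 0)) :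
    TendstoInDistribution Y l Z (fun _ => P) P' := by
  refine ⟨hY, hX.aemeasurable_limit, tendsto_of_forall_isOpen_le_liminf' fun G hG => ?_⟩
  obtain ⟨U, hUmono, hU, hZU, hbad⟩ := h G hG
  simp only [ProbabilityMeasure.coe_mk]
  have hG' : P'.map Z G ≤ P'.map Z (⋃ k, U k) := by
    rw [Measure.map_apply_of_aemeasurable hX.aemeasurable_limit hG.measurableSet,
      Measure.map_apply_of_aemeasurable hX.aemeasurable_limit (isOpen_iUnion hU).measurableSet]
    refine measure_mono_ae ?_
    filter_upwards [hZU] with ω hω hωG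
    exact Set.mem_iUnion.2 (hω hωG)
  refine hG'.trans ?_
  rw [hUmono.measure_iUnion]
  refine iSup_le fun k => ?_
  have h1 := ProbabilityMeasure.le_liminf_measure_open_of_tendsto hX.tendsto (hU k)
  simp only [ProbabilityMeasure.coe_mk] at h1
  refine h1.trans ?_
  have h2 (i : ι) : P.map (X i) (U k) ≤ P.map (Y i) G + P {ω | X i ω ∈ U k ∧ Y i ω ∉ G} := by
    rw [Measure.map_apply_of_aemeasurable (hX.forall_aemeasurable i) (hU k).measurableSet,
      Measure.map_apply_of_aemeasurable (hY i) hG.measurableSet]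
    refine (measure_mono fun ω hω => ?_).trans (measure_union_le _ _)
    by_cases hωG : Y i ω ∈ G
    · exact Or.inl hωG
    · exact Or.inr ⟨hω, hωG⟩
  refine (liminf_le_liminf (.of_forall h2)).trans ?_
  exact (ENNReal.liminf_add_of_right_tendsto_zero (hbad k) _).le

/-- Time changes that tend to the identity, uniformly on compact intervals and in probability, do
not affect convergence in distribution to a process with continuous paths. -/
theorem SkorokhodSpace.tendstoInDistribution_timeChange {ι Ω Ω' : Type*} [MeasurableSpace Ω]
    [MeasurableSpace Ω'] {P : Measure Ω} [IsProbabilityMeasure P] {P' : Measure Ω'}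
    [IsProbabilityMeasure P'] {l : Filter ι} [l.IsCountablyGenerated]
    {X Y : ι → Ω → SkorokhodSpace} {Z : Ω' → SkorokhodSpace}
    (hX : TendstoInDistribution X l Z (fun _ => P) P') (hY : ∀ i, AEMeasurable (Y i) P)
    (hZ : ∀ ω, Continuous (Z ω).path) (τ : ι → Ω → ℝ≥0 → ℝ≥0)
    (hτ : ∀ᶠ i in l, ∀ ω t, (Y i ω).path t = (X i ω).path (τ i ω t))
    (hsmall : ∀ k : ℕ, Tendsto (fun i => P {ω | ∃ t ≤ (k : ℝ≥0) + 1,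
      1 / ((k : ℝ) + 1) < dist (τ i ω t) t}) l (𝓝 0)) :
    TendstoInDistribution Y l Z (fun _ => P) P' := by
  refine hX.of_forall_isOpen hY fun G hG => ?_
  let H (k : ℕ) : Set SkorokhodSpace := {x | ∀ (σ : ℝ≥0 → ℝ≥0) (z : SkorokhodSpace),
      (∀ t ≤ (k : ℝ≥0) + 1, dist (σ t) t ≤ 1 / ((k : ℝ) + 1) ∧ z.path t = x.path (σ t)) → z ∈ G}
  have hH : Monotone H := fun k k' hkk' x hx σ z hz => hx σ z fun t ht => by
    obtain ⟨h1, h2⟩ := hz t (ht.trans (by gcongr))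
    exact ⟨h1.trans (by gcongr), h2⟩
  refine ⟨fun k => interior (H k), fun k k' hkk' => interior_mono (hH hkk'),
    fun k => isOpen_interior, .of_forall fun ω hω => ?_, fun k => ?_⟩
  · obtain ⟨k, hk⟩ := exists_mem_nhds_of_timeChange (hZ ω) (hG.mem_nhds hω)
    exact ⟨k, mem_interior_iff_mem_nhds.2 hk⟩
  · refine tendsto_of_tendsto_of_tendsto_of_le_of_le' tendsto_const_nhds (hsmall k)
      (.of_forall fun _ => bot_le) ?_
    filter_upwards [hτ] with i hi
    refine measure_mono fun ω ⟨hωU, hωG⟩ => ?_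
    by_contra! hcon
    simp only [Set.mem_ofPred_eq, not_exists, not_and, not_lt] at hcon
    exact hωG (interior_subset hωU (τ i ω) _ fun t ht => ⟨hcon t ht, hi ω t⟩)

theorem mainTheorem8
    {Ω Ω' : Type*} [MeasurableSpace Ω] [MeasurableSpace Ω']
    (P : Measure Ω) [IsProbabilityMeasure P] (P' : Measure Ω') [IsProbabilityMeasure P']
    -- the process `W`, with sample paths in `D([0,∞), ℝ)`
    (W : ℝ≥0 → Ω → ℝ) (hW : ∀ t, Measurable (W t))
    (hWpath : ∀ ω, IsCadlag (fun t => W t ω))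
    -- the process `α`; the time-changed process makes sense and has sample paths in `D([0,∞), ℝ)`
    (α : ℝ≥0 → Ω → ℝ) (hα : ∀ t, Measurable (α t))
    (hα_nonneg : ∀ (t : ℝ≥0) ω, 0 ≤ (t : ℝ) + α t ω)
    (hWαpath : ∀ ω, IsCadlag (fun t : ℝ≥0 => W ((t : ℝ) + α t ω).toNNReal ω))
    -- `sup_{0 ≤ t ≤ T} |m⁻¹ α(mt)| → 0` in probability, for every `T`
    (hα_small : ∀ T : ℝ≥0, 0 < T → ∀ ε : ℝ, 0 < ε →
      Tendsto
        (fun m : ℝ≥0 => P {ω | ENNReal.ofReal ε <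
          ⨆ t : Set.Icc (0 : ℝ≥0) T, ENNReal.ofReal |(m : ℝ)⁻¹ * α (m * (t : ℝ≥0)) ω|})
        atTop (𝓝 0))
    -- a standard Brownian motion `B`
    (B : ℝ≥0 → Ω' → ℝ) (hB : IsBrownianReal B P') (hBpath : ∀ ω, Continuous (fun t => B t ω)) :
    (TendstoInDistribution
        (fun (m : ℝ≥0) (ω : Ω) => SkorokhodSpace.mk
          (fun t => (√(m : ℝ))⁻¹ * W (m * t) ω) ((hWpath ω).scale _ m))
        atTop (fun ω => SkorokhodSpace.mk (fun t => B t ω) (hBpath ω).isCadlag)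
        (fun _ => P) P' →
      TendstoInDistribution
        (fun (m : ℝ≥0) (ω : Ω) => SkorokhodSpace.mk
          (fun t => (√(m : ℝ))⁻¹ * W (((m * t : ℝ≥0) : ℝ) + α (m * t) ω).toNNReal ω)
          ((hWαpath ω).scale _ m))
        atTop (fun ω => SkorokhodSpace.mk (fun t => B t ω) (hBpath ω).isCadlag)
        (fun _ => P) P') ∧
    (TendstoInDistribution
        (fun (m : ℝ≥0) (ω : Ω) => SkorokhodSpace.mk
          (fun t => (√(m : ℝ))⁻¹ * W (m * t) ω) ((hWpath ω).scale _ m))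
        atTop (fun ω => SkorokhodSpace.mk (fun t => |B t ω|) (hBpath ω).abs.isCadlag)
        (fun _ => P) P' →
      TendstoInDistribution
        (fun (m : ℝ≥0) (ω : Ω) => SkorokhodSpace.mk
          (fun t => (√(m : ℝ))⁻¹ * W (((m * t : ℝ≥0) : ℝ) + α (m * t) ω).toNNReal ω)
          ((hWαpath ω).scale _ m))
        atTop (fun ω => SkorokhodSpace.mk (fun t => |B t ω|) (hBpath ω).abs.isCadlag)
        (fun _ => P) P') := by
  have key {Z : Ω' → SkorokhodSpace} (hZ : ∀ ω, Continuous (Z ω).path)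
      (h : TendstoInDistribution
        (fun (m : ℝ≥0) (ω : Ω) => SkorokhodSpace.mk
          (fun t => (√(m : ℝ))⁻¹ * W (m * t) ω) ((hWpath ω).scale _ m)) atTop Z (fun _ => P) P') :
      TendstoInDistribution
        (fun (m : ℝ≥0) (ω : Ω) => SkorokhodSpace.mk
          (fun t => (√(m : ℝ))⁻¹ * W (((m * t : ℝ≥0) : ℝ) + α (m * t) ω).toNNReal ω)
          ((hWαpath ω).scale _ m)) atTop Z (fun _ => P) P' := by
    -- the time change is `t ↦ t + m⁻¹ α (m t)`; for `m = 0` the quotient is junk, but only large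
    -- `m` matter
    refine SkorokhodSpace.tendstoInDistribution_timeChange h (fun m => ?_) hZ
      (fun m ω t => (((m * t : ℝ≥0) : ℝ) + α (m * t) ω).toNNReal / m) ?_ fun k => ?_
    · refine (SkorokhodSpace.measurable_of_eval fun t => ?_).aemeasurable
      exact (measurable_process_comp hW hWpath
        ((hα (m * t)).const_add _).real_toNNReal).const_mul _
    · filter_upwards [eventually_gt_atTop 0] with m hm ω t
      simp only [mul_div_cancel₀ _ hm.ne']
    · refine tendsto_of_tendsto_of_tendsto_of_le_of_le' tendsto_const_nhds
        (hα_small (k + 1) (by positivity) (1 / (k + 1)) (by positivity))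
        (.of_forall fun _ => bot_le) ?_
      filter_upwards [eventually_gt_atTop 0] with m hm
      refine measure_mono fun ω ⟨t, ht, hlt⟩ => ?_
      refine ((ENNReal.ofReal_lt_ofReal_iff_of_nonneg (by positivity)).2 hlt).trans_le ?_
      refine le_trans (le_of_eq ?_) (le_iSup (fun t : Set.Icc (0 : ℝ≥0) (k + 1) =>
        ENNReal.ofReal |(m : ℝ)⁻¹ * α (m * (t : ℝ≥0)) ω|) ⟨t, zero_le, ht⟩)
      have hm' : (m : ℝ) ≠ 0 := NNReal.coe_ne_zero.2 hm.ne'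
      rw [NNReal.dist_eq, NNReal.coe_div, Real.coe_toNNReal _ (hα_nonneg _ ω)]
      congr 2
      push_cast
      field_simp
      ring
  exact ⟨key hBpath, key fun ω => (hBpath ω).abs⟩
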